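/- A lattice polytope in $\mathbb R^n$ is the convex hull of a finite subset of $\mathbb Z^n$. A smooth Fano polytope is a lattice polytope $P\subset\mathbb R^n$ that contains the origin in its interior and is such that the vertices of each facet of $P$ form a $\mathbb Z$-basis of $\mathbb Z^n$. A polytope $P$ is called facet-symmetric if it has a facet $F$ such that $-F$ is also a facet of $P$. The superpotential of a lattice polytope $P$ with vertex set $\mathrm{vert}(P)\subset\mathbb Z^n$ is the Laurent polynomial $$W_P(x)=\sum_{v\in \mathrm{vert}(P)} x^v,\qquad x^v=x_1^{v_1}\cdots x_n^{v_n},\qquad x\in(\mathbb C\setminus\{0\})^n.$$ Theorem. Let $P\subset\mathbb R^n$ be a facet-symmetric smooth Fano polytope. Then all critical points of $W_P$ are non-degenerate: if $x\in(\mathbb C\setminus\{0\})^n$ satisfies $\frac{\partial W_P}{\partial x_i}(x)=0$ for all $i=1,\dots,n$, then $$\det\left(\frac{\partial^2 W_P}{\partial x_i\,\partial x_j}(x)\right)_{i,j=1}^{n}\neq 0.$$ -/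

import Mathlib

open scoped Pointwise

namespace ToricFano

/-- The inclusion of the lattice `ℤⁿ` into `ℝⁿ`. -/
def toReal {n : ℕ} (v : Fin n → ℤ) : Fin n → ℝ := fun i => (v i : ℝ)

/-- A lattice polytope in `ℝⁿ`: the convex hull of finitely many points of `ℤⁿ`. -/
def IsLatticePolytope {n : ℕ} (P : Set (Fin n → ℝ)) : Prop :=
  ∃ S : Finset (Fin n → ℤ), P = convexHull ℝ (toReal '' (S : Set (Fin n → ℤ)))

/-- `F` is a facet of `P`: a nonempty face (the set of points of `P` at which some linear
functional attains its maximum over `P`) of dimension `dim P - 1`. -/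
def IsFacet {n : ℕ} (P F : Set (Fin n → ℝ)) : Prop :=
  F.Nonempty ∧ IsExposed ℝ P F ∧
    Module.finrank ℝ (vectorSpan ℝ F) + 1 = Module.finrank ℝ (vectorSpan ℝ P)

/-- A smooth Fano polytope in `ℝⁿ`: a lattice polytope with the origin in its interior such that
the vertices of each facet form a basis of the lattice `ℤⁿ`. (Such a polytope is reflexive:
every facet lies on a hyperplane `⟨u, ·⟩ = 1` with `u` integral.) -/
structure IsSmoothFano {n : ℕ} (P : Set (Fin n → ℝ)) : Prop where
  isLatticePolytope : IsLatticePolytope P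
  zero_mem_interior : (0 : Fin n → ℝ) ∈ interior P
  exists_basis_of_isFacet : ∀ F : Set (Fin n → ℝ), IsFacet P F →
    ∃ b : Module.Basis (Fin n) ℤ (Fin n → ℤ), F.extremePoints ℝ = toReal '' Set.range b

/-- `P` is facet-symmetric: some facet `F` of `P` has a reflection `-F` in the origin that is
also a facet of `P`. -/
def IsFacetSymmetric {n : ℕ} (P : Set (Fin n → ℝ)) : Prop :=
  ∃ F : Set (Fin n → ℝ), IsFacet P F ∧ IsFacet P (-F)

/-- The vertices of a lattice polytope, as elements of `ℤⁿ`. -/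
def vert {n : ℕ} (P : Set (Fin n → ℝ)) : Set (Fin n → ℤ) :=
  {v | toReal v ∈ P.extremePoints ℝ}

theorem toReal_injective {n : ℕ} :
    Function.Injective (toReal : (Fin n → ℤ) → (Fin n → ℝ)) := by
  intro v w h
  funext i
  have hi : ((v i : ℤ) : ℝ) = (w i : ℝ) := congrFun h i
  exact_mod_cast hi

/-- Every vertex of a lattice polytope is a lattice point. -/
theorem toReal_image_vert {n : ℕ} {P : Set (Fin n → ℝ)} (hP : IsLatticePolytope P) :
    toReal '' vert P = P.extremePoints ℝ := by
  obtain ⟨S, rfl⟩ := hP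
  apply Set.Subset.antisymm
  · rintro _ ⟨v, hv, rfl⟩
    exact hv
  · intro x hx
    obtain ⟨v, -, rfl⟩ := extremePoints_convexHull_subset hx
    exact ⟨v, hx, rfl⟩

/-- A lattice polytope has finitely many vertices. -/
theorem vert_finite {n : ℕ} {P : Set (Fin n → ℝ)} (hP : IsLatticePolytope P) :
    (vert P).Finite := by
  obtain ⟨S, rfl⟩ := hP
  refine S.finite_toSet.subset fun v hv => ?_
  obtain ⟨w, hw, h⟩ := extremePoints_convexHull_subset hv
  exact toReal_injective h ▸ hw

/-- The superpotential `W_P(x) = ∑_{v ∈ vert P} x₁^{v₁} ⋯ xₙ^{vₙ}`, a Laurent polynomial viewed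
as a function; it is used only at points with all coordinates nonzero. The sum is finite, by
`vert_finite`. -/
noncomputable def superpotential {n : ℕ} (P : Set (Fin n → ℝ)) (x : Fin n → ℂ) : ℂ :=
  ∑ᶠ v ∈ vert P, ∏ i, x i ^ v i

/-- The partial derivative `∂f/∂xᵢ`. -/
noncomputable def partialDeriv {n : ℕ} (i : Fin n) (f : (Fin n → ℂ) → ℂ) (x : Fin n → ℂ) : ℂ :=
  lineDeriv ℂ f x (Pi.single i 1)

/-- `x` is a critical point, in the torus `(ℂ \ {0})ⁿ`, of `f`. -/
def IsCriticalPoint {n : ℕ} (f : (Fin n → ℂ) → ℂ) (x : Fin n → ℂ) : Prop :=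
  (∀ i, x i ≠ 0) ∧ ∀ i, partialDeriv i f x = 0

/-- The Hessian matrix `(∂²f/∂xᵢ∂xⱼ)` at `x`. -/
noncomputable def hessian {n : ℕ} (f : (Fin n → ℂ) → ℂ) (x : Fin n → ℂ) :
    Matrix (Fin n) (Fin n) ℂ :=
  Matrix.of fun i j => partialDeriv i (partialDeriv j f) x

end ToricFano

namespace ToricFano

/-! Let `b` be the lattice basis formed by the vertices of `F`, and measure height by the sum of
`b`-coordinates. Since `F` and `-F` are facets, every vertex has height 1, 0 or -1, and those of
height ±1 are the `±b i`. Comparing `F` and `-F` with their neighbouring facets shows that vertices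
of height 0 have coordinates in {0, 1, -1}, and that two of them with overlapping supports are equal
or opposite (`IsSmoothFano.eq_or_eq_neg`).

At a critical point the Hessian is, up to scaling rows and columns by the coordinates of `x`, the
logarithmic one (`hessian_mul_mul`), which may be computed in the coordinates `y i = x^(b i)`. There
the potential splits: a coordinate on no height-0 vertex contributes `y + y⁻¹`, which is
non-degenerate. Each vertex `w` of height 0, up to sign, gives a block on its support, of even size
because its coordinates ±1 sum to zero. Putting `z k = y k ^ (w k)` and `t = ∏ z k`, the block is `∑
(z k + (z k)⁻¹) + t + ε t⁻¹`, with `ε = 1` or `0` according to whether `-w` is a vertex.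

The critical equations of a block force every `z k` to be one of two numbers `z`, `-z⁻¹`, occurring
`p` and `q` times. Its logarithmic Hessian is diagonal plus rank one, so degeneracy becomes a scalar
equation in `z`, `p`, `q`, which `nondegenerate_two_roots` refutes by parity (`p + q` is even). -/

/-! ### Algebra of a single block. -/

theorem succ_pow_succ_ne_four_mul_pred_pow_pred (s : ℕ) (hs : Even s) :
    (s + 1 : ℤ) ^ (s + 1) * (s - 1) ≠ 4 * (s - 1 : ℤ) ^ s := by
  intro h
  obtain ⟨k, rfl⟩ := hs
  rcases Nat.eq_zero_or_pos k with rfl | hk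
  · norm_num at h
  have hpar : Even ((((k + k : ℕ) : ℤ) + 1) ^ (k + k + 1) * (((k + k : ℕ) : ℤ) - 1)) := by
    rw [h]; exact ⟨2 * (((k + k : ℕ) : ℤ) - 1) ^ (k + k), by ring⟩
  have h1 : Odd (((k + k : ℕ) : ℤ) + 1) := ⟨k, by push_cast; ring⟩
  have h2 : Odd (((k + k : ℕ) : ℤ) - 1) := ⟨k - 1, by push_cast; ring⟩
  exact Int.not_even_iff_odd.mpr ((h1.pow).mul h2) hpar

/-- Substituting `Z = (s + 1)/(s - 1)` and clearing denominators turns an equality into one between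
integers, odd on one side and divisible by 4 on the other. -/
theorem sq_sub_one_ne_pow {s : ℕ} (hs : Even s) {Z : ℂ}
    (hZ : Z * (s - 1) = s + 1) : (Z - 1) ^ 2 ≠ Z ^ (s + 1) := by
  intro h
  have hs1 : (s : ℂ) - 1 ≠ 0 := by
    intro h0
    have : (s : ℂ) = 1 := by linear_combination h0
    have : s = 1 := by exact_mod_cast this
    subst this
    exact absurd hs (by decide)
  apply succ_pow_succ_ne_four_mul_pred_pow_pred s hs
  have h1 : (Z - 1) * (s - 1) = 2 := by linear_combination hZ
  have h2 : (Z * (s - 1)) ^ (s + 1) = 4 * ((s : ℂ) - 1) ^ s / (s - 1) := by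
    rw [mul_pow, ← h, eq_div_iff hs1, pow_succ (_ - 1 : ℂ) s]
    linear_combination ((s : ℂ) - 1) ^ s * ((Z - 1) * (s - 1) + 2) * h1
  rw [hZ, eq_div_iff hs1] at h2
  exact_mod_cast h2

/-- The case of one root of `z - z⁻¹ = c` occurring `p` times and the other one, `-z⁻¹`,
occurring `q` times. -/
theorem nondegenerate_two_roots {z t ε : ℂ} {p q : ℕ} (hpq : Even (p + q)) (hz : z ≠ 0)
    (ht : t = z ^ p * (-z⁻¹) ^ q) (hε : ε = 0 ∨ ε = 1) (h : z - z⁻¹ + (t - ε * t⁻¹) = 0) :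
    z + z⁻¹ ≠ 0 ∧ z + z⁻¹ + (t + ε * t⁻¹) * (p - q) ≠ 0 := by
  have ht0 : t ≠ 0 := by
    rw [ht]; exact mul_ne_zero (pow_ne_zero _ hz) (pow_ne_zero _ (neg_ne_zero.mpr (inv_ne_zero hz)))
  -- If `z⁻¹ = -z`, the two roots coincide, so `t = z ^ (p + q)` and `t ^ 2 = 1`. For `ε = 0` the
  -- equation `t = -2z` gives `t ^ 2 = -4`; for `ε = 1` it gives `z = 0`.
  have hd : z + z⁻¹ ≠ 0 := by
    intro h0
    have hzi : z⁻¹ = -z := by linear_combination h0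
    have hz2 : z ^ 2 = -1 := by
      have := mul_inv_cancel₀ hz
      rw [hzi] at this
      linear_combination -this
    have htt : t ^ 2 = 1 := by
      rw [ht, hzi, neg_neg, ← pow_add, ← pow_mul, mul_comm, pow_mul, hz2, hpq.neg_one_pow]
    have hti : t⁻¹ = t := inv_eq_of_mul_eq_one_right (by linear_combination htt)
    rw [hzi, hti] at h
    rcases hε with rfl | rfl
    · have : (5 : ℂ) = 0 := by linear_combination -(2 * z - t) * h + 4 * hz2 - htt
      norm_num at this
    · exact hz (by linear_combination h / 2)
  refine ⟨hd, fun h0 => ?_⟩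
  have hzz := mul_inv_cancel₀ hz
  have htt := mul_inv_cancel₀ ht0
  rcases hε with rfl | rfl
  · have ht' : t = z⁻¹ - z := by linear_combination h
    have hZ1 : z ^ 2 * ((p : ℂ) - q - 1) = p - q + 1 := by
      rw [ht'] at h0
      linear_combination -z * h0 + (1 + ((p : ℂ) - q)) * hzz
    -- Squaring removes the sign of `-z⁻¹` and leaves a relation in `Z = z ^ 2` alone.
    have ht2 : (z ^ 2 - 1) ^ 2 * (z ^ 2) ^ q = z ^ 2 * (z ^ 2) ^ p := by
      have e1 : t * z = 1 - z ^ 2 := by rw [ht']; linear_combination hzz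
      have e2 : t ^ 2 * (z ^ 2) ^ q = (z ^ 2) ^ p := by
        rw [ht, mul_pow, mul_assoc, ← pow_mul (-z⁻¹), mul_comm q 2, pow_mul (-z⁻¹), neg_sq,
          ← mul_pow, ← mul_pow, inv_mul_cancel₀ hz, one_pow, one_pow, mul_one, ← pow_mul,
          ← pow_mul, mul_comm]
      rw [← e2]
      linear_combination -(t * z + 1 - z ^ 2) * (z ^ 2) ^ q * e1
    have hZ0 : z ^ 2 ≠ 0 := pow_ne_zero _ hz
    rcases le_total q p with hle | hle
    · obtain ⟨s, rfl⟩ := Nat.exists_eq_add_of_le hle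
      have hs : Even s := by
        rw [show q + s + q = 2 * q + s by ring, Nat.even_add] at hpq
        exact hpq.mp (even_two_mul q)
      refine sq_sub_one_ne_pow hs (Z := z ^ 2) ?_ ?_
      · push_cast at hZ1; linear_combination hZ1
      · apply mul_right_cancel₀ (pow_ne_zero q hZ0)
        rw [ht2]; ring
    -- Exchanging the two roots replaces `Z` by `Z⁻¹` and `p - q` by its negative.
    · obtain ⟨s, rfl⟩ := Nat.exists_eq_add_of_le hle
      have hs : Even s := by
        rw [show p + (p + s) = 2 * p + s by ring, Nat.even_add] at hpq
        exact hpq.mp (even_two_mul p)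
      push_cast at hZ1
      refine sq_sub_one_ne_pow hs (Z := (z ^ 2)⁻¹) ?_ ?_
      · rw [inv_mul_eq_iff_eq_mul₀ hZ0]; linear_combination hZ1
      · have : (z ^ 2 - 1) ^ 2 * (z ^ 2) ^ s = z ^ 2 := by
          apply mul_right_cancel₀ (pow_ne_zero p hZ0)
          rw [← ht2]; ring
        rw [inv_pow]
        apply eq_inv_of_mul_eq_one_left
        rw [pow_succ (z ^ 2) s]
        have e : (z ^ 2)⁻¹ - 1 = (1 - z ^ 2) * (z ^ 2)⁻¹ := by
          rw [sub_mul, mul_inv_cancel₀ hZ0, one_mul]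
        rw [e]
        have hc := mul_inv_cancel₀ hZ0
        linear_combination ((z ^ 2)⁻¹) ^ 2 * z ^ 2 * this + (z ^ 2 * (z ^ 2)⁻¹ + 1) * hc
  -- For `ε = 1` the number `-t` is a root of the same quadratic as `z`, so `t` is `z⁻¹` or `-z`.
  -- Either way the second expression is `z + z⁻¹` times an odd integer.
  · have hfac : (t - z⁻¹) * (t + z) = 0 := by
      linear_combination t * h + htt - hzz
    have hne : ∀ m : ℤ, Odd m → (z + z⁻¹) * m ≠ 0 := fun m hm =>
      mul_ne_zero hd (by
        intro h; have : m = 0 := by exact_mod_cast h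
        subst this; exact absurd hm (by decide))
    have hev : Even ((p : ℤ) - q) := by
      rw [Int.even_sub]; rw [Nat.even_add] at hpq; exact_mod_cast hpq
    rcases mul_eq_zero.mp hfac with h1 | h1
    · have : t = z⁻¹ := by linear_combination h1
      rw [this, inv_inv] at h0
      refine hne (1 + (p - q)) (by simpa using (odd_one.add_even hev)) ?_
      push_cast; linear_combination h0
    · have : t = -z := by linear_combination h1
      rw [this, inv_neg] at h0
      refine hne (1 - (p - q)) (by simpa using (odd_one.sub_even hev)) ?_
      push_cast; linear_combination h0

/-- The factor `z i + (z i)⁻¹` is `d` at one root and `-d` at the other. Hence summing `h2` with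
these signs gives a scalar equation for `θ = ∑ η k` alone; once `θ = 0`, each `η i` vanishes because
`d ≠ 0`. -/
theorem eq_zero_of_block {ι : Type*} (S : Finset ι) (hS : Even S.card) (z η : ι → ℂ)
    (hz : ∀ i ∈ S, z i ≠ 0) (ε : ℂ) (hε : ε = 0 ∨ ε = 1)
    (h1 : ∀ i ∈ S, z i - (z i)⁻¹ + (∏ k ∈ S, z k - ε * (∏ k ∈ S, z k)⁻¹) = 0)
    (h2 : ∀ i ∈ S, (z i + (z i)⁻¹) * η i + (∏ k ∈ S, z k + ε * (∏ k ∈ S, z k)⁻¹) * ∑ k ∈ S, η k = 0) :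
    ∀ i ∈ S, η i = 0 := by
  classical
  intro i₀ hi₀
  set t := ∏ k ∈ S, z k with ht
  set θ := ∑ k ∈ S, η k with hθ
  set w := z i₀ with hw
  have hw0 : w ≠ 0 := hz i₀ hi₀
  have hroot : ∀ i ∈ S, z i ≠ w → z i = -w⁻¹ := by
    intro i hi hne
    have e := h1 i hi
    have e0 := h1 i₀ hi₀
    have a := mul_inv_cancel₀ (hz i hi)
    have b := mul_inv_cancel₀ hw0
    have : (z i - w) * (z i + w⁻¹) = 0 := by
      linear_combination z i * e - z i * e0 + a - b
    rcases mul_eq_zero.mp this with h | h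
    · exact absurd (sub_eq_zero.mp h) hne
    · linear_combination h
  set p := (S.filter (fun i => z i = w)).card with hp
  set q := (S.filter (fun i => ¬ z i = w)).card with hq
  have hpq : p + q = S.card := Finset.card_filter_add_card_filter_not _
  have htpq : t = w ^ p * (-w⁻¹) ^ q := by
    rw [ht, ← Finset.prod_filter_mul_prod_filter_not S (fun i => z i = w), hp, hq,
      ← Finset.prod_const, ← Finset.prod_const]
    congr 1
    · exact Finset.prod_congr rfl fun i hi => (Finset.mem_filter.mp hi).2
    · exact Finset.prod_congr rfl fun i hi =>
        hroot i (Finset.mem_filter.mp hi).1 (Finset.mem_filter.mp hi).2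
  obtain ⟨hd, hne⟩ := nondegenerate_two_roots (hpq ▸ hS) hw0 htpq hε (h1 i₀ hi₀)
  set d := w + w⁻¹ with hdd
  set τ := t + ε * t⁻¹ with hτ
  have hsum : d * θ = -(τ * θ * (p - q)) := by
    have e1 : ∑ i ∈ S.filter (fun i => z i = w), d * η i = p * -(τ * θ) := by
      rw [hp, ← nsmul_eq_mul, ← Finset.sum_const]
      refine Finset.sum_congr rfl fun i hi => ?_
      obtain ⟨hi, hiw⟩ := Finset.mem_filter.mp hi
      have := h2 i hi
      rw [hiw] at this
      linear_combination this
    have e2 : ∑ i ∈ S.filter (fun i => ¬ z i = w), d * η i = q * (τ * θ) := by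
      rw [hq, ← nsmul_eq_mul, ← Finset.sum_const]
      refine Finset.sum_congr rfl fun i hi => ?_
      obtain ⟨hi, hiw⟩ := Finset.mem_filter.mp hi
      have := h2 i hi
      rw [hroot i hi hiw, inv_neg, inv_inv] at this
      linear_combination -this
    have e3 := Finset.sum_filter_add_sum_filter_not S (fun i => z i = w) (fun i => d * η i)
    rw [e1, e2, ← Finset.mul_sum, ← hθ] at e3
    linear_combination -e3
  have hθ0 : θ = 0 := by
    have : (d + τ * (p - q)) * θ = 0 := by linear_combination hsum
    exact (mul_eq_zero.mp this).resolve_left hne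
  have := h2 i₀ hi₀
  rw [hθ0, mul_zero, add_zero] at this
  exact (mul_eq_zero.mp this).resolve_left hd

/-! ### Laurent monomials and the logarithmic Hessian. -/

/-- The Laurent monomial `x^v`. -/
noncomputable def monomial {n : ℕ} (v : Fin n → ℤ) (x : Fin n → ℂ) : ℂ := ∏ i, x i ^ v i

section
variable {n : ℕ} {x : Fin n → ℂ}

theorem monomial_ne_zero (hx : ∀ i, x i ≠ 0) (v : Fin n → ℤ) : monomial v x ≠ 0 :=
  Finset.prod_ne_zero_iff.mpr fun i _ => zpow_ne_zero _ (hx i)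

theorem monomial_add (hx : ∀ i, x i ≠ 0) (v w : Fin n → ℤ) :
    monomial (v + w) x = monomial v x * monomial w x := by
  simp only [monomial, ← Finset.prod_mul_distrib]
  exact Finset.prod_congr rfl fun i _ => zpow_add₀ (hx i) _ _

theorem monomial_zero : monomial 0 x = 1 := by simp [monomial]

theorem monomial_single (i : Fin n) : monomial (Pi.single i 1) x = x i := by
  rw [monomial, Finset.prod_eq_single i] <;> simp +contextual

theorem monomial_neg (v : Fin n → ℤ) : monomial (-v) x = (monomial v x)⁻¹ := by
  simp [monomial, zpow_neg]

theorem monomial_zsmul (m : ℤ) (v : Fin n → ℤ) : monomial (m • v) x = monomial v x ^ m := by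
  simp only [monomial, ← Finset.prod_zpow]
  exact Finset.prod_congr rfl fun i _ => by simp [mul_comm m, zpow_mul]

theorem monomial_sum (hx : ∀ i, x i ≠ 0) {ι : Type*} (s : Finset ι) (v : ι → Fin n → ℤ) :
    monomial (∑ k ∈ s, v k) x = ∏ k ∈ s, monomial (v k) x := by
  classical
  induction s using Finset.induction_on with
  | empty => simp [monomial_zero]
  | insert a s ha ih => rw [Finset.sum_insert ha, Finset.prod_insert ha, monomial_add hx, ih]

theorem hasLineDerivAt_monomial (hx : ∀ i, x i ≠ 0) (v : Fin n → ℤ) (i : Fin n) :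
    HasLineDerivAt ℂ (monomial v) (v i * monomial (v - Pi.single i 1) x) x (Pi.single i 1) := by
  have hline : ∀ t : ℂ, monomial v (x + t • Pi.single i 1) =
      (x i + t) ^ v i * ∏ k ∈ Finset.univ.erase i, x k ^ v k := by
    intro t
    rw [monomial, ← Finset.mul_prod_erase _ _ (Finset.mem_univ i)]
    congr 1
    · simp
    · refine Finset.prod_congr rfl fun k hk => ?_
      simp [Finset.ne_of_mem_erase hk]
  have hval : monomial (v - Pi.single i 1) x =
      x i ^ (v i - 1) * ∏ k ∈ Finset.univ.erase i, x k ^ v k := by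
    rw [monomial, ← Finset.mul_prod_erase _ _ (Finset.mem_univ i)]
    congr 1
    · simp
    · refine Finset.prod_congr rfl fun k hk => ?_
      simp [Finset.ne_of_mem_erase hk]
  rw [HasLineDerivAt, hval]
  change HasDerivAt (fun t : ℂ => monomial v (x + t • Pi.single i 1)) _ _
  rw [funext hline]
  have h1 : HasDerivAt (fun t : ℂ => (x i + t) ^ v i) (v i * (x i + 0) ^ (v i - 1) * 1) 0 :=
    (hasDerivAt_zpow (v i) (x i + 0) (Or.inl (by simpa using hx i))).comp 0
      ((hasDerivAt_id (0 : ℂ)).const_add (x i))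
  have h2 := h1.mul_const (∏ k ∈ Finset.univ.erase i, x k ^ v k)
  rw [add_zero, mul_one, mul_assoc] at h2
  exact h2

theorem partialDeriv_sum_monomial (hx : ∀ i, x i ≠ 0) {ι : Type*} (s : Finset ι) (c : ι → ℂ)
    (v : ι → Fin n → ℤ) (i : Fin n) :
    partialDeriv i (fun y => ∑ k ∈ s, c k * monomial (v k) y) x =
      ∑ k ∈ s, c k * (v k i * monomial (v k - Pi.single i 1) x) := by
  refine HasLineDerivAt.lineDeriv ?_
  have := fun k => (hasLineDerivAt_monomial hx (v k) i)
  simp only [HasLineDerivAt] at this ⊢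
  exact HasDerivAt.fun_sum fun k _ => (this k).const_mul (c k)

/-- The torus is open. This permits differentiating a second time the formula for the first
derivatives, which is known only on the torus. -/
theorem partialDeriv_congr {f g : (Fin n → ℂ) → ℂ} (h : ∀ y : Fin n → ℂ, (∀ i, y i ≠ 0) → f y = g y)
    (hx : ∀ i, x i ≠ 0) (i : Fin n) : partialDeriv i f x = partialDeriv i g x := by
  refine Filter.EventuallyEq.lineDeriv_eq ?_
  have : ∀ᶠ y in nhds x, ∀ i, y i ≠ 0 := by
    rw [Filter.eventually_all]
    exact fun i => (continuous_apply i).continuousAt.eventually_ne (hx i)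
  filter_upwards [this] with y hy using h y hy

theorem superpotential_eq_sum {P : Set (Fin n → ℝ)} {V : Finset (Fin n → ℤ)} (hV : (V : Set _) = vert P) :
    superpotential P = fun y => ∑ v ∈ V, (1 : ℂ) * monomial v y := by
  funext y
  rw [superpotential, ← hV, finsum_mem_coe_finset]
  simp [monomial]

theorem partialDeriv_superpotential {P : Set (Fin n → ℝ)} {V : Finset (Fin n → ℤ)}
    (hV : (V : Set _) = vert P) (hx : ∀ i, x i ≠ 0) (i : Fin n) :
    partialDeriv i (superpotential P) x =
      ∑ v ∈ V, (v i : ℂ) * monomial (v - Pi.single i 1) x := by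
  rw [superpotential_eq_sum hV, partialDeriv_sum_monomial hx]
  simp

theorem monomial_sub_single (hx : ∀ i, x i ≠ 0) (v : Fin n → ℤ) (i : Fin n) :
    monomial (v - Pi.single i 1) x * x i = monomial v x := by
  conv_rhs => rw [← sub_add_cancel v (Pi.single i 1), monomial_add hx, monomial_single]

theorem sum_mul_monomial_eq_zero {P : Set (Fin n → ℝ)} {V : Finset (Fin n → ℤ)}
    (hV : (V : Set _) = vert P) (hx : IsCriticalPoint (superpotential P) x) (i : Fin n) :
    ∑ v ∈ V, (v i : ℂ) * monomial v x = 0 := by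
  have h := hx.2 i
  rw [partialDeriv_superpotential hV hx.1] at h
  calc _ = (∑ v ∈ V, (v i : ℂ) * monomial (v - Pi.single i 1) x) * x i := by
        rw [Finset.sum_mul]
        exact Finset.sum_congr rfl fun v _ => by
          rw [mul_assoc, monomial_sub_single hx.1]
    _ = 0 := by rw [h, zero_mul]

theorem hessian_mul_mul {P : Set (Fin n → ℝ)} {V : Finset (Fin n → ℤ)}
    (hV : (V : Set _) = vert P) (hx : IsCriticalPoint (superpotential P) x) (i j : Fin n) :
    x i * hessian (superpotential P) x i j * x j =
      ∑ v ∈ V, monomial v x * v i * v j := by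
  have h1 : hessian (superpotential P) x i j =
      ∑ v ∈ V, (v j : ℂ) * (((v - Pi.single j 1 : Fin n → ℤ) i : ℤ) *
        monomial (v - Pi.single j 1 - Pi.single i 1) x) := by
    rw [hessian, Matrix.of_apply,
      partialDeriv_congr (fun y hy => partialDeriv_superpotential hV hy j) hx.1,
      partialDeriv_sum_monomial hx.1]
  -- The ordinary and logarithmic Hessians differ by this diagonal term, a multiple of the
  -- first-order equation.
  have h2 : ∑ v ∈ V, (v j : ℂ) * ((Pi.single j 1 : Fin n → ℤ) i : ℤ) * monomial v x = 0 := by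
    have := congrArg (· * (((Pi.single j 1 : Fin n → ℤ) i : ℤ) : ℂ)) (sum_mul_monomial_eq_zero hV hx j)
    simp only [Finset.sum_mul, zero_mul] at this
    rw [← this]
    exact Finset.sum_congr rfl fun v _ => by ring
  rw [h1, Finset.mul_sum, Finset.sum_mul, ← add_zero (∑ v ∈ V, _ * _ * _), ← h2,
    ← Finset.sum_add_distrib, ← sub_eq_zero, ← Finset.sum_sub_distrib]
  refine Finset.sum_eq_zero fun v _ => ?_
  have e1 := monomial_sub_single hx.1 (v - Pi.single j 1) i
  have e2 := monomial_sub_single hx.1 v j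
  rw [← e2, ← e1, Pi.sub_apply]
  push_cast
  ring

theorem det_hessian_ne_zero {P : Set (Fin n → ℝ)} {V : Finset (Fin n → ℤ)}
    (hV : (V : Set _) = vert P) (hx : IsCriticalPoint (superpotential P) x)
    (h : ∀ ξ : Fin n → ℂ, (∀ i, ∑ v ∈ V, monomial v x * v i * ∑ j, v j * ξ j = 0) → ξ = 0) :
    (hessian (superpotential P) x).det ≠ 0 := by
  intro hdet
  obtain ⟨ζ, hζ0, hζ⟩ := Matrix.exists_mulVec_eq_zero_iff.mpr hdet
  apply hζ0
  have := h (fun j => ζ j / x j) fun i => by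
    calc ∑ v ∈ V, monomial v x * v i * ∑ j, v j * (ζ j / x j)
        = ∑ j, (∑ v ∈ V, monomial v x * v i * v j) * (ζ j / x j) := by
          simp only [Finset.mul_sum, Finset.sum_mul]
          rw [Finset.sum_comm]
          exact Finset.sum_congr rfl fun v _ => Finset.sum_congr rfl fun v _ => by ring
      _ = x i * (Matrix.mulVec (hessian (superpotential P) x) ζ) i := by
          simp only [← hessian_mul_mul hV hx, Matrix.mulVec, dotProduct, Finset.mul_sum]
          refine Finset.sum_congr rfl fun j _ => ?_
          have := hx.1 j
          field_simp
      _ = 0 := by rw [hζ]; simp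
  funext j
  have := congrFun this j
  simpa [hx.1 j] using this

end

/-! ### Lattice bases, facets and their height functionals. -/

section
variable {n : ℕ}

theorem toReal_sum_smul {ι : Type*} (s : Finset ι) (c : ι → ℤ) (v : ι → Fin n → ℤ) :
    toReal (∑ k ∈ s, c k • v k) = ∑ k ∈ s, (c k : ℝ) • toReal (v k) := by
  ext i
  simp [toReal, Finset.sum_apply]

theorem toReal_neg (v : Fin n → ℤ) : toReal (-v) = -toReal v := by
  ext i; simp [toReal]

theorem top_le_span_toReal_basis (b : Module.Basis (Fin n) ℤ (Fin n → ℤ)) :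
    ⊤ ≤ Submodule.span ℝ (Set.range fun k => toReal (b k)) := by
  rw [← (Pi.basisFun ℝ (Fin n)).span_eq, Submodule.span_le]
  rintro _ ⟨i, rfl⟩
  have h : Pi.basisFun ℝ (Fin n) i = toReal (Pi.single i 1) := by
    ext j; simp [toReal, Pi.single_apply]
  rw [h, ← b.sum_repr (Pi.single i 1), toReal_sum_smul]
  exact Submodule.sum_mem _ fun k _ =>
    Submodule.smul_mem _ _ (Submodule.subset_span ⟨k, rfl⟩)

/-- The basis of `ℝⁿ` given by a basis of `ℤⁿ`. -/
noncomputable def realBasis (b : Module.Basis (Fin n) ℤ (Fin n → ℤ)) :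
    Module.Basis (Fin n) ℝ (Fin n → ℝ) :=
  basisOfTopLeSpanOfCardEqFinrank (fun k => toReal (b k)) (top_le_span_toReal_basis b) (by simp)

theorem realBasis_apply (b : Module.Basis (Fin n) ℤ (Fin n → ℤ)) (k : Fin n) :
    realBasis b k = toReal (b k) := by
  simp [realBasis]

theorem realBasis_coord_toReal (b : Module.Basis (Fin n) ℤ (Fin n → ℤ)) (v : Fin n → ℤ)
    (k : Fin n) : (realBasis b).coord k (toReal v) = b.repr v k := by
  conv_lhs => rw [← b.sum_repr v, toReal_sum_smul]
  simp only [← realBasis_apply]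
  rw [Module.Basis.coord_apply, Module.Basis.repr_sum_self]

/-- The sum of the coordinates with respect to a basis of the lattice. -/
noncomputable def latticeHeight (b : Module.Basis (Fin n) ℤ (Fin n → ℤ)) (v : Fin n → ℤ) : ℤ :=
  ∑ k, b.repr v k

/-- The linear functional on `ℝⁿ` that is `1` on a given basis of the lattice. -/
noncomputable def height (b : Module.Basis (Fin n) ℤ (Fin n → ℤ)) : (Fin n → ℝ) →ₗ[ℝ] ℝ :=
  ∑ k, (realBasis b).coord k

theorem height_toReal (b : Module.Basis (Fin n) ℤ (Fin n → ℤ)) (v : Fin n → ℤ) :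
    height b (toReal v) = latticeHeight b v := by
  simp only [height, latticeHeight, LinearMap.sum_apply, realBasis_coord_toReal]
  push_cast
  rfl

theorem latticeHeight_self (b : Module.Basis (Fin n) ℤ (Fin n → ℤ)) (k : Fin n) :
    latticeHeight b (b k) = 1 := by
  simp [latticeHeight, Finsupp.single_apply]

theorem latticeHeight_neg (b : Module.Basis (Fin n) ℤ (Fin n → ℤ)) (v : Fin n → ℤ) :
    latticeHeight b (-v) = -latticeHeight b v := by
  simp [latticeHeight]

theorem eq_smul_height (b : Module.Basis (Fin n) ℤ (Fin n → ℤ)) (l : (Fin n → ℝ) →ₗ[ℝ] ℝ) (M : ℝ)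
    (h : ∀ k, l (toReal (b k)) = M) : l = M • height b := by
  refine (realBasis b).ext fun k => ?_
  rw [realBasis_apply, h, LinearMap.smul_apply, height_toReal, latticeHeight_self]
  simp

/-- The vertices of some facet of `P` are the members of the lattice basis `b`. -/
def IsFacetBasis (P : Set (Fin n → ℝ)) (b : Module.Basis (Fin n) ℤ (Fin n → ℤ)) : Prop :=
  ∃ F, IsFacet P F ∧ F.extremePoints ℝ = toReal '' Set.range b

variable {P : Set (Fin n → ℝ)} {b : Module.Basis (Fin n) ℤ (Fin n → ℤ)}

/-- A functional exposing `F` is constant on `b`, hence a multiple of `height b`. The factor is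
nonnegative since `0 ∈ P`, and nonzero since otherwise `F = P`, against the dimension. -/
theorem IsFacet.eq_height_eq_one {F : Set (Fin n → ℝ)} (h0 : 0 ∈ P) (hF : IsFacet P F)
    (hb : F.extremePoints ℝ = toReal '' Set.range b) :
    F = {x ∈ P | height b x = 1} ∧ ∀ x ∈ P, height b x ≤ 1 := by
  obtain ⟨⟨x₀, hx₀⟩, hexp, hrank⟩ := hF
  obtain ⟨l, hl⟩ := hexp ⟨x₀, hx₀⟩
  have hx₀' := hx₀
  rw [hl] at hx₀'
  have hmem : ∀ x, x ∈ F ↔ x ∈ P ∧ l x = l x₀ := by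
    intro x
    rw [hl]
    exact ⟨fun h => ⟨h.1, le_antisymm (hx₀'.2 x h.1) (h.2 x₀ hx₀'.1)⟩,
      fun h => ⟨h.1, fun y hy => h.2 ▸ hx₀'.2 y hy⟩⟩
  have hbF : ∀ k, toReal (b k) ∈ F := fun k =>
    extremePoints_subset (hb ▸ ⟨b k, ⟨k, rfl⟩, rfl⟩ : toReal (b k) ∈ F.extremePoints ℝ)
  have hlM : (l : (Fin n → ℝ) →ₗ[ℝ] ℝ) = l x₀ • height b :=
    eq_smul_height b _ _ fun k => ((hmem _).mp (hbF k)).2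
  have hlM' : ∀ x, l x = l x₀ * height b x := fun x => by
    simpa using LinearMap.congr_fun hlM x
  have hM0 : 0 ≤ l x₀ := by simpa using hx₀'.2 0 h0
  have hM : l x₀ ≠ 0 := by
    intro hM
    have : F = P := by
      ext x
      rw [hmem, hlM' x, hM]; simp
    rw [this] at hrank
    omega
  have hMpos := lt_of_le_of_ne hM0 hM.symm
  constructor
  · ext x
    rw [hmem, hlM' x, mul_eq_left₀ hM]
    rfl
  · intro x hx
    have := hx₀'.2 x hx
    rw [hlM' x] at this
    exact le_of_mul_le_mul_left (by simpa using this) hMpos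

theorem IsFacet.extremePoints_eq {F : Set (Fin n → ℝ)} (hF : IsFacet P F) :
    F.extremePoints ℝ = F ∩ P.extremePoints ℝ :=
  (hF.2.1.isExtreme).extremePoints_eq

theorem IsFacetBasis.mem_vert (hb : IsFacetBasis P b) (k : Fin n) : b k ∈ vert P := by
  obtain ⟨F, hF, h⟩ := hb
  have : toReal (b k) ∈ F.extremePoints ℝ := h ▸ ⟨b k, ⟨k, rfl⟩, rfl⟩
  rw [hF.extremePoints_eq] at this
  exact this.2

theorem IsFacetBasis.height_le_one (h0 : 0 ∈ P) (hb : IsFacetBasis P b) {x : Fin n → ℝ}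
    (hx : x ∈ P) : height b x ≤ 1 := by
  obtain ⟨F, hF, h⟩ := hb
  exact (hF.eq_height_eq_one h0 h).2 x hx

theorem IsFacetBasis.latticeHeight_le_one (h0 : 0 ∈ P) (hb : IsFacetBasis P b) {v : Fin n → ℤ}
    (hv : v ∈ vert P) : latticeHeight b v ≤ 1 := by
  have := hb.height_le_one h0 hv.1
  rw [height_toReal] at this
  exact_mod_cast this

theorem IsFacetBasis.mem_range (h0 : 0 ∈ P) (hb : IsFacetBasis P b) {v : Fin n → ℤ}
    (hv : v ∈ vert P) (h1 : latticeHeight b v = 1) : v ∈ Set.range b := by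
  obtain ⟨F, hF, h⟩ := hb
  have hvF : toReal v ∈ F.extremePoints ℝ := by
    rw [hF.extremePoints_eq]
    refine ⟨?_, hv⟩
    rw [(hF.eq_height_eq_one h0 h).1]
    exact ⟨hv.1, by rw [height_toReal, h1, Int.cast_one]⟩
  rw [h] at hvF
  obtain ⟨w, hw, hwv⟩ := hvF
  exact toReal_injective hwv ▸ hw

theorem IsLatticePolytope.eq_convexHull_vert (hP : IsLatticePolytope P) :
    P = convexHull ℝ (toReal '' vert P) := by
  have hfin := (vert_finite hP).image toReal
  have himg := toReal_image_vert hP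
  have hcc : IsCompact P ∧ Convex ℝ P := by
    obtain ⟨S, rfl⟩ := hP
    exact ⟨(S.finite_toSet.image _).isCompact_convexHull ℝ, convex_convexHull ℝ _⟩
  have := closure_convexHull_extremePoints hcc.1 hcc.2
  rw [← himg, (hfin.isClosed_convexHull ℝ).closure_eq] at this
  exact this.symm

theorem IsLatticePolytope.exists_vert_repr_neg (hP : IsLatticePolytope P)
    (h0 : (0 : Fin n → ℝ) ∈ interior P) (b : Module.Basis (Fin n) ℤ (Fin n → ℤ)) (i : Fin n) :
    ∃ v ∈ vert P, b.repr v i < 0 := by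
  by_contra! h
  have hpos : P ⊆ {x | 0 ≤ (realBasis b).coord i x} := by
    rw [hP.eq_convexHull_vert]
    refine convexHull_min ?_ (convex_halfSpace_ge ((realBasis b).coord i).isLinear 0)
    rintro _ ⟨v, hv, rfl⟩
    rw [Set.mem_ofPred_eq, realBasis_coord_toReal]
    exact_mod_cast h v hv
  have hcont : Filter.Tendsto (fun s : ℝ => s • realBasis b i) (nhdsWithin 0 (Set.Iio 0)) (nhds 0) := by
    have : Continuous fun s : ℝ => s • realBasis b i := by fun_prop
    have h2 := this.tendsto 0
    rw [zero_smul] at h2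
    exact h2.mono_left nhdsWithin_le_nhds
  have hev := (hcont.eventually (mem_interior_iff_mem_nhds.mp h0)).and self_mem_nhdsWithin
  obtain ⟨s, hs, hs0⟩ := hev.exists
  have : 0 ≤ (realBasis b).coord i (s • realBasis b i) := hpos hs
  simp at this
  exact absurd hs0 (not_lt.mpr this)

theorem finrank_vectorSpan_eq (h0 : (0 : Fin n → ℝ) ∈ interior P) :
    Module.finrank ℝ (vectorSpan ℝ P) = n := by
  have h1 : affineSpan ℝ P = ⊤ := top_unique <|
    isOpen_interior.affineSpan_eq_top ⟨0, h0⟩ ▸ affineSpan_mono ℝ interior_subset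
  rw [← direction_affineSpan, h1, AffineSubspace.direction_top, finrank_top]
  simp

theorem finrank_vectorSpan_add_one {G : Set (Fin n → ℝ)} (l : (Fin n → ℝ) →ₗ[ℝ] ℝ)
    (hl : ∀ x ∈ G, l x = 1) (hne : G.Nonempty) (hG : Submodule.span ℝ G = ⊤) :
    Module.finrank ℝ (vectorSpan ℝ G) + 1 = n := by
  obtain ⟨g, hg⟩ := hne
  have hker : vectorSpan ℝ G ≤ LinearMap.ker l := by
    rw [vectorSpan, Submodule.span_le]
    rintro _ ⟨x, hx, y, hy, rfl⟩
    simp [hl x hx, hl y hy]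
  have hlt : Module.finrank ℝ (vectorSpan ℝ G) < Module.finrank ℝ (Fin n → ℝ) := by
    refine Submodule.finrank_lt fun htop => ?_
    have := hker (htop ▸ Submodule.mem_top : g ∈ vectorSpan ℝ G)
    rw [LinearMap.mem_ker, hl g hg] at this
    exact one_ne_zero this
  have hsup : vectorSpan ℝ G ⊔ Submodule.span ℝ {g} = ⊤ := by
    rw [eq_top_iff, ← hG, Submodule.span_le]
    intro x hx
    rw [← sub_add_cancel x g]
    exact Submodule.add_mem_sup (vsub_mem_vectorSpan ℝ hx hg) (Submodule.mem_span_singleton_self g)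
  have h1 := Submodule.finrank_add_le_finrank_add_finrank (vectorSpan ℝ G) (Submodule.span ℝ {g})
  have h2 : Module.finrank ℝ (Submodule.span ℝ {g}) ≤ 1 := by
    simpa using finrank_span_le_card (R := ℝ) ({g} : Set (Fin n → ℝ))
  rw [hsup, finrank_top] at h1
  simp only [Module.finrank_fin_fun] at h1 hlt
  omega

/-! ### Neighbouring facets. -/

/-- The facet next to the one with vertices `b` across the ridge opposite to `b i`. -/
theorem IsSmoothFano.exists_neighbour (hP : IsSmoothFano P) (hb : IsFacetBasis P b) (i : Fin n) :
    ∃ (m : ℤ) (b' : Module.Basis (Fin n) ℤ (Fin n → ℤ)), 1 ≤ m ∧ IsFacetBasis P b' ∧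
      (∀ v, latticeHeight b' v = latticeHeight b v - m * b.repr v i) ∧
      ∀ j ≠ i, b j ∈ Set.range b' := by
  classical
  have h0 : (0 : Fin n → ℝ) ∈ P := interior_subset hP.zero_mem_interior
  have hfin := vert_finite hP.isLatticePolytope
  obtain ⟨v₁, hv₁, hv₁neg⟩ :=
    hP.isLatticePolytope.exists_vert_repr_neg hP.zero_mem_interior b i
  -- Ratio test of the simplex method: the hyperplane of the facet is tilted about the ridge until
  -- it first meets a vertex, `v₀`.
  obtain ⟨v₀, hv₀mem, hmin⟩ := Finset.exists_min_image
    (hfin.toFinset.filter fun v => b.repr v i < 0)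
    (fun v => (1 - (latticeHeight b v : ℝ)) / (-(b.repr v i : ℝ))) ⟨v₁, by simp [hv₁, hv₁neg]⟩
  simp only [Finset.mem_filter, Set.Finite.mem_toFinset] at hv₀mem hmin
  obtain ⟨hv₀, hneg₀⟩ := hv₀mem
  have hneg : (0 : ℝ) < -(b.repr v₀ i : ℝ) := by
    have : (b.repr v₀ i : ℝ) < 0 := by exact_mod_cast hneg₀
    linarith
  set t := (1 - (latticeHeight b v₀ : ℝ)) / (-(b.repr v₀ i : ℝ)) with ht
  have hh₀ : latticeHeight b v₀ < 1 := by
    refine lt_of_le_of_ne (hb.latticeHeight_le_one h0 hv₀) fun h1 => ?_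
    obtain ⟨k, rfl⟩ := hb.mem_range h0 hv₀ h1
    rw [b.repr_self, Finsupp.single_apply] at hneg₀
    split_ifs at hneg₀ <;> omega
  have htpos : 0 < t := by
    refine div_pos ?_ hneg
    have : (latticeHeight b v₀ : ℝ) < 1 := by exact_mod_cast hh₀
    linarith
  set l : (Fin n → ℝ) →ₗ[ℝ] ℝ := height b - t • (realBasis b).coord i with hl
  have hlv : ∀ v, l (toReal v) = latticeHeight b v - t * b.repr v i := by
    intro v
    rw [hl, LinearMap.sub_apply, LinearMap.smul_apply, height_toReal, realBasis_coord_toReal,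
      smul_eq_mul]
  have hle : P ⊆ {x | l x ≤ 1} := by
    conv_lhs => rw [hP.isLatticePolytope.eq_convexHull_vert]
    refine convexHull_min ?_ (convex_halfSpace_le l.isLinear 1)
    rintro _ ⟨v, hv, rfl⟩
    rw [Set.mem_ofPred_eq, hlv]
    have h1 : (latticeHeight b v : ℝ) ≤ 1 := by exact_mod_cast hb.latticeHeight_le_one h0 hv
    rcases lt_or_ge (b.repr v i) 0 with hc | hc
    · have hc' : (0 : ℝ) < -(b.repr v i : ℝ) := by
        have : (b.repr v i : ℝ) < 0 := by exact_mod_cast hc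
        linarith
      have := hmin v ⟨hv, hc⟩
      rw [le_div_iff₀ hc'] at this
      linarith
    · have hc' : (0 : ℝ) ≤ b.repr v i := by exact_mod_cast hc
      have := mul_nonneg htpos.le hc'
      linarith
  set G := {x ∈ P | l x = 1} with hG
  have hv₀G : toReal v₀ ∈ G := by
    refine ⟨hv₀.1, ?_⟩
    have : t * (-(b.repr v₀ i : ℝ)) = 1 - latticeHeight b v₀ := div_mul_cancel₀ _ hneg.ne'
    rw [hlv]
    linarith
  have hlb : ∀ j ≠ i, l (toReal (b j)) = 1 := by
    intro j hj
    rw [hlv, latticeHeight_self, b.repr_self, Finsupp.single_eq_of_ne hj.symm]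
    simp
  have hbG : ∀ j ≠ i, toReal (b j) ∈ G := fun j hj => ⟨(hb.mem_vert j).1, hlb j hj⟩
  have hspan : Submodule.span ℝ G = ⊤ := by
    have hj : ∀ j ≠ i, toReal (b j) ∈ Submodule.span ℝ G := fun j hj =>
      Submodule.subset_span (hbG j hj)
    rw [eq_top_iff, ← (realBasis b).span_eq, Submodule.span_le]
    rintro _ ⟨j, rfl⟩
    rw [realBasis_apply]
    by_cases hji : j = i
    · subst hji
      have h1 : toReal v₀ = ∑ k, (b.repr v₀ k : ℝ) • toReal (b k) := by
        rw [← toReal_sum_smul, b.sum_repr]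
      rw [← Finset.add_sum_erase _ _ (Finset.mem_univ j)] at h1
      have h2 : (b.repr v₀ j : ℝ) • toReal (b j) ∈ Submodule.span ℝ G := by
        rw [← sub_eq_iff_eq_add] at h1
        rw [← h1]
        exact Submodule.sub_mem _ (Submodule.subset_span hv₀G) (Submodule.sum_mem _ fun k hk =>
          Submodule.smul_mem _ _ (hj k (Finset.ne_of_mem_erase hk)))
      rwa [SetLike.mem_coe, ← Submodule.smul_mem_iff _ (by linarith : (b.repr v₀ j : ℝ) ≠ 0)]
    · exact hj j hji
  have hfacet : IsFacet P G := by
    refine ⟨⟨_, hv₀G⟩, fun _ => ⟨LinearMap.toContinuousLinearMap l, ?_⟩, ?_⟩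
    · ext x
      constructor
      · rintro ⟨hx, hx1⟩
        exact ⟨hx, fun y hy => (hle hy).trans_eq hx1.symm⟩
      · rintro ⟨hx, hx1⟩
        exact ⟨hx, le_antisymm (hle hx) (hv₀G.2 ▸ hx1 _ hv₀G.1)⟩
    · rw [finrank_vectorSpan_eq hP.zero_mem_interior]
      exact finrank_vectorSpan_add_one l (fun x hx => hx.2) ⟨_, hv₀G⟩ hspan
  obtain ⟨b', hb'⟩ := hP.exists_basis_of_isFacet G hfacet
  have hfb : IsFacetBasis P b' := ⟨G, hfacet, hb'⟩
  have hlh : l = height b' := by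
    rw [← one_smul ℝ (height b')]
    refine eq_smul_height b' l 1 fun k => ?_
    have : toReal (b' k) ∈ G.extremePoints ℝ := hb' ▸ ⟨b' k, ⟨k, rfl⟩, rfl⟩
    exact (extremePoints_subset this).2
  have hh' : ∀ v, (latticeHeight b' v : ℝ) = latticeHeight b v - t * b.repr v i := by
    intro v
    rw [← hlv, hlh, height_toReal]
  -- Smoothness of the new facet makes `t` an integer, as evaluation at `b i` shows; being positive,
  -- it is at least 1.
  have htm : t = ((1 - latticeHeight b' (b i) : ℤ) : ℝ) := by
    have := hh' (b i)
    rw [latticeHeight_self, b.repr_self, Finsupp.single_eq_same] at this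
    push_cast at this ⊢
    linarith
  refine ⟨1 - latticeHeight b' (b i), b', ?_, hfb, fun v => ?_, fun j hj => ?_⟩
  · have : (0 : ℝ) < ((1 - latticeHeight b' (b i) : ℤ) : ℝ) := htm ▸ htpos
    have : 0 < 1 - latticeHeight b' (b i) := by exact_mod_cast this
    omega
  · have := hh' v
    rw [htm] at this
    exact_mod_cast this
  · refine hfb.mem_range h0 (hb.mem_vert j) ?_
    have := hlb j hj
    rw [hlh, height_toReal] at this
    exact_mod_cast this

theorem IsSmoothFano.neg_one_le_repr (hP : IsSmoothFano P) (hb : IsFacetBasis P b) {v : Fin n → ℤ}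
    (hv : v ∈ vert P) (h : latticeHeight b v = 0) (i : Fin n) : -1 ≤ b.repr v i := by
  obtain ⟨m, b', hm, hb', hh, -⟩ := hP.exists_neighbour hb i
  have := hb'.latticeHeight_le_one (interior_subset hP.zero_mem_interior) hv
  rw [hh, h] at this
  nlinarith

/-- Such a vertex has height `m ≥ 1` over the neighbouring facet, so it lies on that facet and
replaces `b i`. One `b'` serves all `v`, which is what yields uniqueness of `v`. -/
theorem IsSmoothFano.exists_update (hP : IsSmoothFano P) (hb : IsFacetBasis P b) (i : Fin n) :
    ∃ b' : Module.Basis (Fin n) ℤ (Fin n → ℤ), IsFacetBasis P b' ∧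
      ∀ v ∈ vert P, latticeHeight b v = 0 → b.repr v i = -1 → ⇑b' = Function.update b i v := by
  classical
  have h0 : (0 : Fin n → ℝ) ∈ P := interior_subset hP.zero_mem_interior
  obtain ⟨m, b', hm, hb', hh, hr⟩ := hP.exists_neighbour hb i
  by_cases hex : ∃ v ∈ vert P, latticeHeight b v = 0 ∧ b.repr v i = -1
  swap
  · exact ⟨b, hb, fun v hv h1 h2 => absurd ⟨v, hv, h1, h2⟩ hex⟩
  have hmem : ∀ v ∈ vert P, latticeHeight b v = 0 → b.repr v i = -1 → v ∈ Set.range b' := by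
    intro v hv h1 h2
    have := hb'.latticeHeight_le_one h0 hv
    refine hb'.mem_range h0 hv ?_
    rw [hh, h1, h2] at this ⊢
    omega
  have hne : ∀ v, latticeHeight b v = 0 → ∀ j, b j ≠ v := by
    rintro v h1 j rfl
    rw [latticeHeight_self] at h1
    exact one_ne_zero h1
  have hinj : ∀ v, latticeHeight b v = 0 → Function.Injective (Function.update b i v) := by
    intro v h1 j k hjk
    simp only [Function.update_apply] at hjk
    split_ifs at hjk with hj hk hk
    · rw [hj, hk]
    · exact absurd hjk.symm (hne v h1 k)
    · exact absurd hjk (hne v h1 j)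
    · exact b.injective hjk
  have hsub : ∀ v ∈ vert P, latticeHeight b v = 0 → b.repr v i = -1 →
      ∀ j, Function.update b i v j ∈ Set.range b' := by
    intro v hv h1 h2 j
    by_cases hj : j = i
    · subst hj; rw [Function.update_self]; exact hmem v hv h1 h2
    · rw [Function.update_of_ne hj]; exact hr j hj
  obtain ⟨v, hv, h1, h2⟩ := hex
  choose e he using hsub v hv h1 h2
  have heinj : Function.Injective e := fun j k hjk => hinj v h1 (by rw [← he, ← he, hjk])
  -- The bases agree as sets; `σ` puts them in the same order.
  let σ := Equiv.ofBijective e (Finite.injective_iff_bijective.mp heinj)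
  have hσ : ⇑(b'.reindex σ.symm) = Function.update b i v := by
    funext j
    rw [Module.Basis.reindex_apply, Equiv.symm_symm]
    exact he j
  refine ⟨b'.reindex σ.symm, ?_, fun w hw hw1 hw2 => ?_⟩
  · obtain ⟨F, hF, h⟩ := hb'
    exact ⟨F, hF, by rw [Module.Basis.range_reindex, h]⟩
  · obtain ⟨k, hk⟩ := hmem w hw hw1 hw2
    obtain ⟨j, rfl⟩ := σ.surjective k
    have : Function.update b i v j = w := by rw [← hk]; exact (he j).symm
    by_cases hj : j = i
    · subst hj
      rw [Function.update_self] at this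
      rw [hσ, this]
    · rw [Function.update_of_ne hj] at this
      exact absurd this (hne w hw1 j)

theorem IsSmoothFano.eq_of_repr_eq_neg_one (hP : IsSmoothFano P) (hb : IsFacetBasis P b)
    {v w : Fin n → ℤ} (hv : v ∈ vert P) (hw : w ∈ vert P) (hv0 : latticeHeight b v = 0)
    (hw0 : latticeHeight b w = 0) {i : Fin n} (hvi : b.repr v i = -1) (hwi : b.repr w i = -1) :
    v = w := by
  obtain ⟨b', -, h⟩ := hP.exists_update hb i
  have := (h v hv hv0 hvi).symm.trans (h w hw hw0 hwi)
  simpa using congrFun this i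

end

/-! ### Vertices of height zero when `F` and `-F` are both facets. -/

section
variable {n : ℕ}

/-- The basis `-b`. -/
noncomputable def negBasis (b : Module.Basis (Fin n) ℤ (Fin n → ℤ)) :
    Module.Basis (Fin n) ℤ (Fin n → ℤ) := b.map (LinearEquiv.neg ℤ)

variable {P : Set (Fin n → ℝ)} {b : Module.Basis (Fin n) ℤ (Fin n → ℤ)}

theorem negBasis_apply (k : Fin n) : negBasis b k = -b k := by simp [negBasis]

theorem negBasis_repr (v : Fin n → ℤ) (k : Fin n) : (negBasis b).repr v k = -b.repr v k := by
  simp [negBasis]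

theorem latticeHeight_negBasis (v : Fin n → ℤ) :
    latticeHeight (negBasis b) v = -latticeHeight b v := by
  simp [latticeHeight, negBasis_repr]

theorem negBasis_negBasis : negBasis (negBasis b) = b :=
  Module.Basis.eq_of_apply_eq fun k => by simp [negBasis_apply]

theorem isFacetBasis_negBasis {F : Set (Fin n → ℝ)} (hF : IsFacet P (-F))
    (hb : F.extremePoints ℝ = toReal '' Set.range b) : IsFacetBasis P (negBasis b) := by
  refine ⟨-F, hF, ?_⟩
  have h := image_extremePoints (𝕜 := ℝ) (LinearEquiv.neg ℝ : (Fin n → ℝ) ≃ₗ[ℝ] (Fin n → ℝ)) F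
  have hneg : ⇑(LinearEquiv.neg ℝ : (Fin n → ℝ) ≃ₗ[ℝ] (Fin n → ℝ)) = fun x => -x := by
    ext x; simp
  rw [hneg, Set.image_neg_eq_neg, Set.image_neg_eq_neg] at h
  rw [← h, hb, ← Set.image_neg_eq_neg, Set.image_image, ← Set.range_comp, ← Set.range_comp]
  congr 1
  funext k
  simp [negBasis_apply, toReal_neg]

theorem IsSmoothFano.repr_mem (hP : IsSmoothFano P) (hb : IsFacetBasis P b)
    (hnb : IsFacetBasis P (negBasis b)) {v : Fin n → ℤ} (hv : v ∈ vert P)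
    (h : latticeHeight b v = 0) (i : Fin n) :
    b.repr v i = 0 ∨ b.repr v i = 1 ∨ b.repr v i = -1 := by
  have h1 := hP.neg_one_le_repr hb hv h i
  have h2 := hP.neg_one_le_repr hnb hv (by rw [latticeHeight_negBasis, h, neg_zero]) i
  rw [negBasis_repr] at h2
  omega

theorem IsSmoothFano.eq_of_repr_eq (hP : IsSmoothFano P) (hb : IsFacetBasis P b)
    (hnb : IsFacetBasis P (negBasis b)) {v w : Fin n → ℤ} (hv : v ∈ vert P) (hw : w ∈ vert P)
    (hv0 : latticeHeight b v = 0) (hw0 : latticeHeight b w = 0) {i : Fin n}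
    (hvi : b.repr v i ≠ 0) (h : b.repr w i = b.repr v i) : w = v := by
  rcases hP.repr_mem hb hnb hv hv0 i with h0 | h1 | h1
  · exact absurd h0 hvi
  · refine hP.eq_of_repr_eq_neg_one hnb hw hv ?_ ?_ (i := i) ?_ ?_
    · rw [latticeHeight_negBasis, hw0, neg_zero]
    · rw [latticeHeight_negBasis, hv0, neg_zero]
    · rw [negBasis_repr, h, h1]
    · rw [negBasis_repr, h1]
  · exact hP.eq_of_repr_eq_neg_one hb hw hv hw0 hv0 (h.trans h1) h1

section
variable {b' : Module.Basis (Fin n) ℤ (Fin n → ℤ)} {w : Fin n → ℤ} {i : Fin n}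

theorem latticeHeight_update (h : ⇑b' = Function.update b i w) (hw0 : latticeHeight b w = 0)
    (hwi : b.repr w i = -1) (x : Fin n → ℤ) :
    latticeHeight b' x = latticeHeight b x - b.repr x i := by
  have hl : ∀ (c : Module.Basis (Fin n) ℤ (Fin n → ℤ)) (x), latticeHeight c x =
      (∑ k, c.coord k) x := fun c x => by simp [latticeHeight, LinearMap.sum_apply]
  suffices (∑ k, b'.coord k) = (∑ k, b.coord k) - b.coord i by
    rw [hl, hl, this]; simp
  refine b'.ext fun k => ?_
  rw [LinearMap.sub_apply, ← hl, ← hl, latticeHeight_self, h, Module.Basis.coord_apply]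
  by_cases hk : k = i
  · subst hk; rw [Function.update_self, hw0, hwi]; norm_num
  · rw [Function.update_of_ne hk, latticeHeight_self, b.repr_self,
      Finsupp.single_eq_of_ne (Ne.symm hk), sub_zero]

theorem repr_update (h : ⇑b' = Function.update b i w) (hwi : b.repr w i = -1) {j : Fin n}
    (hj : j ≠ i) (x : Fin n → ℤ) :
    b'.repr x j = b.repr x j + b.repr x i * b.repr w j := by
  suffices b'.coord j = b.coord j + b.repr w j • b.coord i by
    have := LinearMap.congr_fun this x
    simpa [mul_comm] using this
  refine b'.ext fun k => ?_
  simp only [LinearMap.add_apply, LinearMap.smul_apply, Module.Basis.coord_apply, b'.repr_self, smul_eq_mul]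
  by_cases hk : k = i
  · subst hk
    rw [h, Function.update_self, hwi, Finsupp.single_eq_of_ne hj]
    ring
  · rw [h, Function.update_of_ne hk, b.repr_self, Finsupp.single_eq_of_ne (a := k) (a' := i) (Ne.symm hk)]
    ring

end

/-- If `v` has `j`-coordinate 1, it equals `w`. If it is -1, pass to the facet with `b i` replaced
by `w`: there `v` and `-b i` both have height 0 and `j`-coordinate -1, so they coincide. Both
contradict `hvi`. -/
theorem IsSmoothFano.repr_eq_zero_of_neg_one_of_one (hP : IsSmoothFano P) (hb : IsFacetBasis P b)
    (hnb : IsFacetBasis P (negBasis b)) {v w : Fin n → ℤ} (hv : v ∈ vert P) (hw : w ∈ vert P)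
    (hv0 : latticeHeight b v = 0) (hw0 : latticeHeight b w = 0) {i j : Fin n}
    (hwi : b.repr w i = -1) (hwj : b.repr w j = 1) (hvi : b.repr v i = 0) :
    b.repr v j = 0 := by
  have hji : j ≠ i := by rintro rfl; omega
  rcases hP.repr_mem hb hnb hv hv0 j with h | h | h
  · exact h
  · have := hP.eq_of_repr_eq hb hnb hw hv hw0 hv0 (i := j) (by omega) (by omega)
    subst this
    omega
  · exfalso
    obtain ⟨b', hb', hup⟩ := hP.exists_update hb i
    have hup := hup w hw hw0 hwi
    have hbi : -b i ∈ vert P := negBasis_apply (b := b) i ▸ hnb.mem_vert i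
    have hreprbi : ∀ k, b.repr (-b i) k = -(Finsupp.single i 1 : Fin n →₀ ℤ) k := fun k => by
      rw [map_neg, Finsupp.neg_apply, b.repr_self]
    have hri : b.repr (-b i) i = -1 := by rw [hreprbi, Finsupp.single_eq_same]
    have e : v = -b i := by
      refine hP.eq_of_repr_eq_neg_one hb' hv hbi ?_ ?_ (i := j) ?_ ?_
      · rw [latticeHeight_update hup hw0 hwi, hv0, hvi, sub_zero]
      · rw [latticeHeight_update hup hw0 hwi, hri, latticeHeight_neg, latticeHeight_self]
        norm_num
      · rw [repr_update hup hwi hji, h, hvi, zero_mul, add_zero]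
      · rw [repr_update hup hwi hji, hri, hwj, hreprbi, Finsupp.single_eq_of_ne hji]
        norm_num
    rw [e, hri] at hvi
    omega

theorem IsSmoothFano.repr_eq_zero_of_neg_one (hP : IsSmoothFano P) (hb : IsFacetBasis P b)
    (hnb : IsFacetBasis P (negBasis b)) {v w : Fin n → ℤ} (hv : v ∈ vert P) (hw : w ∈ vert P)
    (hv0 : latticeHeight b v = 0) (hw0 : latticeHeight b w = 0) {i j : Fin n}
    (hwi : b.repr w i = -1) (hwj : b.repr w j ≠ 0) (hvi : b.repr v i = 0) :
    b.repr v j = 0 := by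
  rcases hP.repr_mem hb hnb hw hw0 j with h | h | h
  · exact absurd h hwj
  · exact hP.repr_eq_zero_of_neg_one_of_one hb hnb hv hw hv0 hw0 hwi h hvi
  -- The coordinates of `w` sum to zero, so some `k` has the opposite sign; vanishing passes from
  -- `i` to `k`, then from `k` to `j` with `-b` in place of `b`.
  · obtain ⟨k, hk⟩ : ∃ k, b.repr w k = 1 := by
      by_contra! hne
      have : latticeHeight b w < 0 := by
        refine Finset.sum_neg' (fun k _ => ?_) ⟨i, Finset.mem_univ i, by omega⟩
        have := hne k
        rcases hP.repr_mem hb hnb hw hw0 k with h | h | h <;> omega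
      omega
    have hvk := hP.repr_eq_zero_of_neg_one_of_one hb hnb hv hw hv0 hw0 hwi hk hvi
    have := hP.repr_eq_zero_of_neg_one_of_one hnb (by rwa [negBasis_negBasis]) hv hw
      (by rw [latticeHeight_negBasis, hv0, neg_zero]) (by rw [latticeHeight_negBasis, hw0, neg_zero])
      (i := k) (j := j) (by rw [negBasis_repr, hk]) (by rw [negBasis_repr, h, neg_neg])
      (by rw [negBasis_repr, hvk, neg_zero])
    rw [negBasis_repr] at this
    omega

theorem IsSmoothFano.repr_eq_zero (hP : IsSmoothFano P) (hb : IsFacetBasis P b)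
    (hnb : IsFacetBasis P (negBasis b)) {v w : Fin n → ℤ} (hv : v ∈ vert P) (hw : w ∈ vert P)
    (hv0 : latticeHeight b v = 0) (hw0 : latticeHeight b w = 0) {i j : Fin n}
    (hwi : b.repr w i ≠ 0) (hwj : b.repr w j ≠ 0) (hvi : b.repr v i = 0) :
    b.repr v j = 0 := by
  rcases hP.repr_mem hb hnb hw hw0 i with h | h | h
  · exact absurd h hwi
  · have := hP.repr_eq_zero_of_neg_one hnb (by rwa [negBasis_negBasis]) hv hw
      (by rw [latticeHeight_negBasis, hv0, neg_zero]) (by rw [latticeHeight_negBasis, hw0, neg_zero])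
      (i := i) (j := j) (by rw [negBasis_repr, h]) (by rwa [negBasis_repr, neg_ne_zero])
      (by rw [negBasis_repr, hvi, neg_zero])
    rw [negBasis_repr] at this
    omega
  · exact hP.repr_eq_zero_of_neg_one hb hnb hv hw hv0 hw0 h hwj hvi

/-- Two vertices of height zero whose supports meet are equal or opposite. -/
theorem IsSmoothFano.eq_or_eq_neg (hP : IsSmoothFano P) (hb : IsFacetBasis P b)
    (hnb : IsFacetBasis P (negBasis b)) {v w : Fin n → ℤ} (hv : v ∈ vert P) (hw : w ∈ vert P)
    (hv0 : latticeHeight b v = 0) (hw0 : latticeHeight b w = 0) {i : Fin n}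
    (hvi : b.repr v i ≠ 0) (hwi : b.repr w i ≠ 0) : v = w ∨ v = -w := by
  refine or_iff_not_imp_left.mpr fun hne => b.repr.injective (Finsupp.ext fun j => ?_)
  rw [map_neg, Finsupp.neg_apply]
  -- Sharing one nonzero coordinate would force `v = w`; as the supports agree, all signs are
  -- opposite.
  have h1 : b.repr v j ≠ 0 → b.repr v j ≠ b.repr w j := fun h h' =>
    hne (hP.eq_of_repr_eq hb hnb hw hv hw0 hv0 (h' ▸ h) h')
  have h2 : b.repr v j = 0 → b.repr w j = 0 := fun h => by
    by_contra hwj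
    exact hvi (hP.repr_eq_zero hb hnb hv hw hv0 hw0 hwj hwi h)
  have h3 : b.repr w j = 0 → b.repr v j = 0 := fun h => by
    by_contra hvj
    exact hwi (hP.repr_eq_zero hb hnb hw hv hw0 hv0 hvj hvi h)
  rcases hP.repr_mem hb hnb hv hv0 j with h | h | h <;>
  rcases hP.repr_mem hb hnb hw hw0 j with h' | h' | h' <;> omega

theorem IsSmoothFano.vert_cases (hP : IsSmoothFano P) (hb : IsFacetBasis P b)
    (hnb : IsFacetBasis P (negBasis b)) {v : Fin n → ℤ} (hv : v ∈ vert P) {i : Fin n}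
    (hi : b.repr v i ≠ 0) : v = b i ∨ v = -b i ∨ latticeHeight b v = 0 := by
  have h0 : (0 : Fin n → ℝ) ∈ P := interior_subset hP.zero_mem_interior
  have h1 := hb.latticeHeight_le_one h0 hv
  have h2 := hnb.latticeHeight_le_one h0 hv
  rw [latticeHeight_negBasis] at h2
  have h3 : latticeHeight b v = 1 ∨ latticeHeight b v = -1 ∨ latticeHeight b v = 0 := by omega
  rcases h3 with h | h | h
  · obtain ⟨k, rfl⟩ := hb.mem_range h0 hv h
    rw [b.repr_self, Finsupp.single_apply] at hi
    left
    congr 1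
    by_contra hne
    exact hi (if_neg hne)
  · obtain ⟨k, rfl⟩ := hnb.mem_range h0 hv (by rw [latticeHeight_negBasis, h, neg_neg])
    rw [negBasis_apply, map_neg, Finsupp.neg_apply, b.repr_self, Finsupp.single_apply] at hi
    right; left
    rw [negBasis_apply]
    congr 2
    by_contra hne
    exact hi (by rw [if_neg hne, neg_zero])
  · exact Or.inr (Or.inr h)

theorem basis_ne_neg_basis (i : Fin n) : b i ≠ -b i := by
  intro h
  have := congrArg (latticeHeight b) h
  rw [latticeHeight_neg, latticeHeight_self] at this
  omega

theorem IsSmoothFano.sum_repr_of_forall_eq_zero (hP : IsSmoothFano P) (hb : IsFacetBasis P b)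
    (hnb : IsFacetBasis P (negBasis b)) {V : Finset (Fin n → ℤ)} (hV : (V : Set _) = vert P)
    {i : Fin n} (h : ∀ w ∈ V, latticeHeight b w = 0 → b.repr w i = 0) (g : (Fin n → ℤ) → ℂ) :
    ∑ v ∈ V, g v * b.repr v i = g (b i) - g (-b i) := by
  classical
  have hVm : ∀ v, v ∈ V ↔ v ∈ vert P := fun v => by rw [← hV, Finset.mem_coe]
  have hsub : ({b i, -b i} : Finset (Fin n → ℤ)) ⊆ V := by
    intro v hv
    rw [Finset.mem_insert, Finset.mem_singleton] at hv
    rw [hVm]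
    rcases hv with rfl | rfl
    · exact hb.mem_vert i
    · exact negBasis_apply (b := b) i ▸ hnb.mem_vert i
  rw [← Finset.sum_subset hsub, Finset.sum_pair (basis_ne_neg_basis i)]
  · simp [sub_eq_add_neg]
  · intro v hv hv'
    rw [Finset.mem_insert, Finset.mem_singleton] at hv'
    by_cases hi : b.repr v i = 0
    · simp [hi]
    · rcases hP.vert_cases hb hnb ((hVm v).mp hv) hi with h1 | h1 | h1
      · exact absurd (Or.inl h1) hv'
      · exact absurd (Or.inr h1) hv'
      · exact absurd (h v hv h1) hi

/-- Only `±b i` and `±w` can have a nonzero `i`-th coordinate. The weight `g` is arbitrary so as to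
cover both the critical equations and the kernel equations. -/
theorem IsSmoothFano.sum_repr_of_ne_zero (hP : IsSmoothFano P) (hb : IsFacetBasis P b)
    (hnb : IsFacetBasis P (negBasis b)) {V : Finset (Fin n → ℤ)} (hV : (V : Set _) = vert P)
    {i : Fin n} {w : Fin n → ℤ} (hw : w ∈ V) (hw0 : latticeHeight b w = 0)
    (hwi : b.repr w i ≠ 0) (g : (Fin n → ℤ) → ℂ) :
    ∑ v ∈ V, g v * b.repr v i =
      g (b i) - g (-b i) + b.repr w i * (g w - (if -w ∈ V then 1 else 0) * g (-w)) := by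
  classical
  have hVm : ∀ v, v ∈ V ↔ v ∈ vert P := fun v => by rw [← hV, Finset.mem_coe]
  have hww : w ≠ -w := by
    intro h
    have := congrArg (fun u => b.repr u i) h
    simp only [map_neg, Finsupp.neg_apply] at this
    omega
  have hsplit := Finset.sum_filter_add_sum_filter_not V (fun v => latticeHeight b v = 0)
    (fun v => g v * (b.repr v i : ℂ))
  have h1 : ∑ v ∈ V with ¬ latticeHeight b v = 0, g v * (b.repr v i : ℂ) = g (b i) - g (-b i) := by
    have hsub : ({b i, -b i} : Finset (Fin n → ℤ)) ⊆ V.filter fun v => ¬ latticeHeight b v = 0 := by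
      intro v hv
      rw [Finset.mem_insert, Finset.mem_singleton] at hv
      rw [Finset.mem_filter, hVm]
      rcases hv with rfl | rfl
      · exact ⟨hb.mem_vert i, by rw [latticeHeight_self]; norm_num⟩
      · exact ⟨negBasis_apply (b := b) i ▸ hnb.mem_vert i,
          by rw [latticeHeight_neg, latticeHeight_self]; norm_num⟩
    rw [← Finset.sum_subset hsub, Finset.sum_pair (basis_ne_neg_basis i)]
    · simp [sub_eq_add_neg]
    · intro v hv hv'
      rw [Finset.mem_insert, Finset.mem_singleton] at hv'
      rw [Finset.mem_filter, hVm] at hv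
      by_cases hi : b.repr v i = 0
      · simp [hi]
      · rcases hP.vert_cases hb hnb hv.1 hi with h1 | h1 | h1
        · exact absurd (Or.inl h1) hv'
        · exact absurd (Or.inr h1) hv'
        · exact absurd h1 hv.2
  have h2 : ∑ v ∈ V with latticeHeight b v = 0, g v * (b.repr v i : ℂ) =
      b.repr w i * (g w - (if -w ∈ V then 1 else 0) * g (-w)) := by
    have hz : ∀ v ∈ V.filter (fun v => latticeHeight b v = 0), ¬ (v = w ∨ v = -w) →
        g v * (b.repr v i : ℂ) = 0 := by
      intro v hv hv'
      rw [Finset.mem_filter, hVm] at hv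
      by_cases hi : b.repr v i = 0
      · simp [hi]
      · exact absurd (hP.eq_or_eq_neg hb hnb hv.1 ((hVm w).mp hw) hv.2 hw0 hi hwi) hv'
    by_cases hnw : -w ∈ V
    · rw [if_pos hnw]
      have hsub : ({w, -w} : Finset (Fin n → ℤ)) ⊆ V.filter fun v => latticeHeight b v = 0 := by
        intro v hv
        rw [Finset.mem_insert, Finset.mem_singleton] at hv
        rw [Finset.mem_filter]
        rcases hv with rfl | rfl
        · exact ⟨hw, hw0⟩
        · exact ⟨hnw, by rw [latticeHeight_neg, hw0, neg_zero]⟩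
      rw [← Finset.sum_subset hsub, Finset.sum_pair hww]
      · rw [map_neg, Finsupp.neg_apply]; push_cast; ring
      · intro v hv hv'
        exact hz v hv (by simpa using hv')
    · rw [if_neg hnw, Finset.sum_eq_single_of_mem w (Finset.mem_filter.mpr ⟨hw, hw0⟩)]
      · ring
      · intro v hv hvw
        refine hz v hv ?_
        rintro (h | rfl)
        · exact hvw h
        · exact hnw (Finset.mem_filter.mp hv).1
  rw [← hsplit, h1, h2, add_comm]

/-! ### Splitting the kernel equations into blocks. -/

theorem sum_mul_linearMap_eq_zero (f : (Fin n → ℤ) →ₗ[ℤ] ℤ) (V : Finset (Fin n → ℤ))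
    (g : (Fin n → ℤ) → ℂ) (h : ∀ i, ∑ v ∈ V, g v * v i = 0) : ∑ v ∈ V, g v * f v = 0 := by
  have hf : ∀ v, (f v : ℂ) = ∑ i, (v i : ℂ) * f (Pi.single i 1) := by
    intro v
    rw [LinearMap.pi_apply_eq_sum_univ f v]
    push_cast
    refine Finset.sum_congr rfl fun i _ => ?_
    have : (fun j => if i = j then 1 else 0 : Fin n → ℤ) = Pi.single i 1 := by
      funext j
      simp [Pi.single_apply, eq_comm]
    rw [this, smul_eq_mul, Int.cast_mul]
  rw [Finset.sum_congr rfl fun v _ => by rw [hf v, Finset.mul_sum], Finset.sum_comm]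
  refine Finset.sum_eq_zero fun i _ => ?_
  have := congrArg (· * (f (Pi.single i 1) : ℂ)) (h i)
  simp only [Finset.sum_mul, zero_mul, mul_assoc] at this
  exact this

theorem IsSmoothFano.eq_zero_of_mem_kernel (hP : IsSmoothFano P) (hb : IsFacetBasis P b)
    (hnb : IsFacetBasis P (negBasis b)) {V : Finset (Fin n → ℤ)} (hV : (V : Set _) = vert P)
    {x : Fin n → ℂ} (hx : ∀ i, x i ≠ 0) (hcrit : ∀ i, ∑ v ∈ V, (v i : ℂ) * monomial v x = 0)
    (ξ : Fin n → ℂ) (hξ : ∀ i, ∑ v ∈ V, monomial v x * v i * ∑ j, v j * ξ j = 0) : ξ = 0 := by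
  classical
  let L : (Fin n → ℤ) → ℂ := fun v => ∑ j, (v j : ℂ) * ξ j
  have hLneg : ∀ v, L (-v) = -L v := fun v => by simp [L]
  have hLsum : ∀ v, L v = ∑ k, (b.repr v k : ℂ) * L (b k) := by
    intro v
    have hv : ∀ j, (v j : ℂ) = ∑ k, (b.repr v k : ℂ) * b k j := by
      intro j
      conv_lhs => rw [← b.sum_repr v]
      simp [Finset.sum_apply]
    simp only [L, hv, Finset.mul_sum, Finset.sum_mul]
    rw [Finset.sum_comm]
    exact Finset.sum_congr rfl fun k _ => Finset.sum_congr rfl fun j _ => by ring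
  have hc1 : ∀ i, ∑ v ∈ V, monomial v x * b.repr v i = 0 := fun i =>
    sum_mul_linearMap_eq_zero (b.coord i) V (fun v => monomial v x) fun j => by
      rw [← hcrit j]
      exact Finset.sum_congr rfl fun v _ => mul_comm _ _
  have hc2 : ∀ i, ∑ v ∈ V, (monomial v x * L v) * b.repr v i = 0 := fun i =>
    sum_mul_linearMap_eq_zero (b.coord i) V (fun v => monomial v x * L v) fun j => by
      rw [← hξ j]
      exact Finset.sum_congr rfl fun v _ => mul_right_comm _ _ _
  set y : Fin n → ℂ := fun i => monomial (b i) x with hy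
  have hy0 : ∀ i, y i ≠ 0 := fun i => monomial_ne_zero hx _
  suffices h : ∀ i, L (b i) = 0 by
    funext j
    have h1 := hLsum (Pi.single j 1)
    simp only [h, mul_zero, Finset.sum_const_zero] at h1
    simpa [L, Pi.single_apply] using h1
  intro i
  by_cases hex : ∃ w ∈ V, latticeHeight b w = 0 ∧ b.repr w i ≠ 0
  swap
  · push Not at hex
    have e1 := hc1 i
    have e2 := hc2 i
    rw [hP.sum_repr_of_forall_eq_zero hb hnb hV hex (fun v => monomial v x), monomial_neg] at e1
    rw [hP.sum_repr_of_forall_eq_zero hb hnb hV hex (fun v => monomial v x * L v), monomial_neg,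
      hLneg] at e2
    change y i - (y i)⁻¹ = 0 at e1
    change y i * L (b i) - (y i)⁻¹ * -L (b i) = 0 at e2
    have : 2 * y i * L (b i) = 0 := by linear_combination e2 + L (b i) * e1
    exact (mul_eq_zero.mp this).resolve_left (mul_ne_zero two_ne_zero (hy0 i))
  obtain ⟨w, hw, hw0, hwi⟩ := hex
  have hwP : w ∈ vert P := by rw [← hV]; exact hw
  set S := Finset.univ.filter fun k => b.repr w k ≠ 0 with hS
  have hmemS : ∀ k, k ∈ S ↔ b.repr w k ≠ 0 := fun k => by simp [hS]
  have hpm : ∀ k ∈ S, b.repr w k = 1 ∨ b.repr w k = -1 := fun k hk =>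
    (hP.repr_mem hb hnb hwP hw0 k).resolve_left ((hmemS k).mp hk)
  have hsumS : ∀ f : Fin n → ℂ, ∑ k, (b.repr w k : ℂ) * f k = ∑ k ∈ S, (b.repr w k : ℂ) * f k := by
    intro f
    refine (Finset.sum_subset (Finset.subset_univ S) fun k _ hk => ?_).symm
    rw [hmemS, not_not] at hk
    simp [hk]
  have hcard : Even S.card := by
    have h1 : ∑ k ∈ S, b.repr w k = 0 := by
      rw [← hw0]
      refine Finset.sum_subset (Finset.subset_univ S) fun k _ hk => ?_
      rwa [hmemS, not_not] at hk
    have h2 : ((S.card : ℕ) : ℤ) = ∑ k ∈ S, (1 + b.repr w k) := by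
      rw [Finset.sum_add_distrib, h1]; simp
    rw [← Int.even_coe_nat, h2]
    refine Finset.even_sum _ fun k hk => ?_
    rcases hpm k hk with h | h <;> rw [h] <;> decide
  have hprod : monomial w x = ∏ k ∈ S, y k ^ b.repr w k := by
    conv_lhs => rw [← b.sum_repr w, monomial_sum hx]
    simp only [monomial_zsmul]
    refine (Finset.prod_subset (Finset.subset_univ S) fun k _ hk => ?_).symm
    rw [hmemS, not_not] at hk
    simp [hk]
  have hLw : L w = ∑ k ∈ S, (b.repr w k : ℂ) * L (b k) := by rw [hLsum, hsumS]
  -- Raising `y k` to the power ±1 makes all coordinates of `w` equal to 1; where the exponent is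
  -- -1, the critical and kernel equations change sign.
  have key := eq_zero_of_block S hcard (fun k => y k ^ b.repr w k)
    (fun k => (b.repr w k : ℂ) * L (b k)) (fun k _ => zpow_ne_zero _ (hy0 k))
    (if -w ∈ V then 1 else 0) (by split_ifs <;> simp) ?_ ?_ i ((hmemS i).mpr hwi)
  · exact (mul_eq_zero.mp key).resolve_left (by exact_mod_cast hwi)
  · intro k hk
    have e1 := hc1 k
    rw [hP.sum_repr_of_ne_zero hb hnb hV hw hw0 ((hmemS k).mp hk) (fun v => monomial v x),
      monomial_neg, monomial_neg] at e1
    change y k - (y k)⁻¹ + _ = 0 at e1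
    rw [← hprod]
    rcases hpm k hk with h | h <;> rw [h] at e1 ⊢
    · rw [zpow_one]; push_cast at e1; linear_combination e1
    · rw [zpow_neg_one, inv_inv]; push_cast at e1; linear_combination -e1
  · intro k hk
    have e1 := hc2 k
    rw [hP.sum_repr_of_ne_zero hb hnb hV hw hw0 ((hmemS k).mp hk) (fun v => monomial v x * L v),
      monomial_neg, monomial_neg, hLneg, hLneg] at e1
    change y k * L (b k) - (y k)⁻¹ * -L (b k) + _ = 0 at e1
    rw [← hprod, ← hLw]
    rcases hpm k hk with h | h <;> rw [h] at e1 ⊢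
    · rw [zpow_one]; push_cast at e1 ⊢; linear_combination e1
    · rw [zpow_neg_one, inv_inv]; push_cast at e1 ⊢; linear_combination -e1

end

end ToricFano

theorem mainTheorem3 {n : ℕ} (P : Set (Fin n → ℝ)) (hP : ToricFano.IsSmoothFano P)
    (hsymm : ToricFano.IsFacetSymmetric P) (x : Fin n → ℂ)
    (hx : ToricFano.IsCriticalPoint (ToricFano.superpotential P) x) :
    (ToricFano.hessian (ToricFano.superpotential P) x).det ≠ 0 := by
  obtain ⟨F, hF, hnF⟩ := hsymm
  obtain ⟨b, hbF⟩ := hP.exists_basis_of_isFacet F hF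
  have hV := (ToricFano.vert_finite hP.isLatticePolytope).coe_toFinset
  exact ToricFano.det_hessian_ne_zero hV hx
    (hP.eq_zero_of_mem_kernel ⟨F, hF, hbF⟩ (ToricFano.isFacetBasis_negBasis hnF hbF) hV hx.1
      (ToricFano.sum_mul_monomial_eq_zero hV hx))
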